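/- Corollary 4.3. By a surface group we mean the fundamental group of a connected closed surface, that is, a group isomorphic to $$\langle x_1,y_1,\dots,x_g,y_g \mid [x_1,y_1]\cdots[x_g,y_g]\rangle \quad (g\ge 0)\qquad\text{or}\qquad \langle x_1,\dots,x_k \mid x_1^2\cdots x_k^2\rangle\quad (k\ge 1),$$ where $[x,y]=x^{-1}y^{-1}xy$; the Klein-bottle group is $\langle x_1,x_2\mid x_1^2x_2^2\rangle$. A subgroup $C$ of a group $G$ is called left relatively convex in $G$ if the left $G$-set $G/C$ of left cosets has a $G$-invariant order, i.e. a transitive binary relation $<$ such that for all $a,b\in G/C$ exactly one of $a<b$, $a=b$, $b<a$ holds, and such that $a<b$ if and only if $ga<gb$ for all $g\in G$ and $a,b\in G/C$. Let $G$ be a surface group that is not isomorphic to the Klein-bottle group, and let $C$ be a maximal cyclic subgroup of $G$, i.e. a subgroup that is maximal under inclusion among the cyclic subgroups of $G$. Then $C$ is left relatively convex in $G$. -/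

import Mathlib

/-- A left `G`-set `X` is `G`-orderable if it has a `G`-invariant (strict, total) order: a transitive
relation such that exactly one of `x < y`, `x = y`, `y < x` holds for all `x`, `y`. -/
def IsOrderableGSet (G X : Type*) [Group G] [MulAction G X] : Prop :=
  ∃ r : X → X → Prop, IsStrictTotalOrder X r ∧ ∀ (g : G) (x y : X), r (g • x) (g • y) ↔ r x y

/-- `H` is left relatively convex in `G` if the left `G`-set `G ⧸ H` of left cosets has a
`G`-invariant order. -/
def Subgroup.IsLeftRelativelyConvex {G : Type*} [Group G] (H : Subgroup G) : Prop :=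
  IsOrderableGSet G (G ⧸ H)

/-- `H` is a maximal cyclic subgroup of `G`: it is maximal (under inclusion) among the
cyclic subgroups of `G`. -/
def Subgroup.IsMaximalCyclic {G : Type*} [Group G] (H : Subgroup G) : Prop :=
  Maximal (fun K : Subgroup G => IsCyclic K) H

/-- The relator `[x₁, y₁] ⋯ [x_g, y_g]`, with `[x, y] = x⁻¹ y⁻¹ x y`, in the free group on
`x₁, …, x_g` (the generators `Sum.inl i`) and `y₁, …, y_g` (the generators `Sum.inr i`). -/
def orientableRelator (g : ℕ) : FreeGroup (Fin g ⊕ Fin g) :=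
  (List.ofFn fun i : Fin g =>
    (FreeGroup.of (Sum.inl i))⁻¹ * (FreeGroup.of (Sum.inr i))⁻¹ *
      FreeGroup.of (Sum.inl i) * FreeGroup.of (Sum.inr i)).prod

/-- The fundamental group `⟨x₁, y₁, …, x_g, y_g ∣ [x₁, y₁] ⋯ [x_g, y_g]⟩` of the closed orientable
surface of genus `g` (the sphere for `g = 0`, the torus for `g = 1`). -/
abbrev OrientableSurfaceGroup (g : ℕ) : Type :=
  PresentedGroup ({orientableRelator g} : Set (FreeGroup (Fin g ⊕ Fin g)))

/-- The relator `x₁² ⋯ x_k²` in the free group on `x₁, …, x_k`. -/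
def nonorientableRelator (k : ℕ) : FreeGroup (Fin k) :=
  (List.ofFn fun i : Fin k => FreeGroup.of i ^ 2).prod

/-- For `1 ≤ k`, the fundamental group `⟨x₁, …, x_k ∣ x₁² ⋯ x_k²⟩` of the closed nonorientable
surface that is the connected sum of `k` projective planes (the projective plane for `k = 1`, the
Klein bottle for `k = 2`). -/
abbrev NonorientableSurfaceGroup (k : ℕ) : Type :=
  PresentedGroup ({nonorientableRelator k} : Set (FreeGroup (Fin k)))

/-- The Klein-bottle group `⟨x₁, x₂ ∣ x₁² x₂²⟩`. -/
abbrev KleinBottleGroup : Type := NonorientableSurfaceGroup 2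

/-- `G` is a surface group: up to isomorphism, it is the fundamental group of a connected closed
surface, given by its standard presentation. The sphere and the projective plane are included. -/
def IsSurfaceGroup (G : Type*) [Group G] : Prop :=
  (∃ g : ℕ, Nonempty (G ≃* OrientableSurfaceGroup g)) ∨
    ∃ k : ℕ, 1 ≤ k ∧ Nonempty (G ≃* NonorientableSurfaceGroup k)

/-! By a relative Burns–Hale argument (`Subgroup.isLeftRelativelyConvex_of_forall_exists_hom`), it
suffices that every subgroup `H` properly containing `C = ⟨c⟩` has a nontrivial homomorphism to `ℤ`
killing `c`. Apart from the cyclic surface groups and the Klein-bottle group, a surface group has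
first Betti number at least 2, so some nontrivial `χ` to `ℤ` kills `c`. If `χ` is nontrivial on `H`,
restrict it. Otherwise `H ≤ ker χ`, which is free, being the fundamental group of an infinite cyclic
(noncompact) cover. Then `H` is free, and noncyclic by maximality of `C`, so two independent
homomorphisms to `ℤ` have a combination killing `c`.

Freeness of `ker χ` is proved algebraically (`IsRecursiveGenerator.isFreeGroup_ker`): the group acts
on `ℤ` through `χ`, and in the action groupoid the lifted relations successively eliminate the edges
labelled by one generator `x`, except those ending in a transversal. The remaining edges are free
generators. -/

/-! ### Relative cones and the Burns–Hale criterion -/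

/-- A positive cone relative to `C`: a subsemigroup `P` without `1`, such that the elements outside
`P ∪ P⁻¹` form a subgroup that contains `C` and that stabilizes `P` from both sides. -/
structure IsRelativeCone {G : Type*} [Group G] (C : Subgroup G) (P : Set G) : Prop where
  one_notMem : (1 : G) ∉ P
  mul_mem : ∀ a ∈ P, ∀ b ∈ P, a * b ∈ P
  exists_subgroup : ∃ H : Subgroup G, C ≤ H ∧ (∀ a, a ∈ H ↔ a ∉ P ∧ a⁻¹ ∉ P) ∧
    ∀ h ∈ H, ∀ a ∈ P, h * a ∈ P ∧ a * h ∈ P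

theorem IsRelativeCone.empty {G : Type*} [Group G] (C : Subgroup G) : IsRelativeCone C ∅ :=
  ⟨by simp, by simp, ⊤, by simp, by simp, by simp⟩

/-- The remaining subgroup of the union is the intersection of the remaining subgroups. -/
theorem IsRelativeCone.sUnion {G : Type*} [Group G] {C : Subgroup G} {c : Set (Set G)}
    (hc : ∀ P ∈ c, IsRelativeCone C P) (hchain : IsChain (· ⊆ ·) c) :
    IsRelativeCone C (⋃₀ c) := by
  refine ⟨?_, ?_, ?_⟩
  · rintro ⟨P, hP, h1⟩
    exact (hc P hP).one_notMem h1
  · rintro a ⟨P, hP, ha⟩ b ⟨Q, hQ, hb⟩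
    rcases hchain.total hP hQ with h | h
    · exact ⟨Q, hQ, (hc Q hQ).mul_mem _ (h ha) _ hb⟩
    · exact ⟨P, hP, (hc P hP).mul_mem _ ha _ (h hb)⟩
  · choose! H hCH hH hHP using fun P hP => (hc P hP).exists_subgroup
    refine ⟨⨅ P ∈ c, H P, le_iInf₂ hCH, fun a => ?_, ?_⟩
    · simp only [Subgroup.mem_iInf, Set.mem_sUnion, not_exists, not_and]
      exact ⟨fun h => ⟨fun P hP => ((hH P hP a).1 (h P hP)).1,
        fun P hP => ((hH P hP a).1 (h P hP)).2⟩, fun h P hP => (hH P hP a).2 ⟨h.1 P hP, h.2 P hP⟩⟩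
    · rintro h hh a ⟨P, hP, ha⟩
      simp only [Subgroup.mem_iInf] at hh
      exact ⟨⟨P, hP, (hHP P hP h (hh P hP) a ha).1⟩, ⟨P, hP, (hHP P hP h (hh P hP) a ha).2⟩⟩

/-- The elements of `H` on which `φ` is positive refine a relative cone with remaining subgroup
`H`. -/
theorem IsRelativeCone.union_hom {G : Type*} [Group G] {C H : Subgroup G} {P : Set G}
    (hP : IsRelativeCone C P) (hH : ∀ a, a ∈ H ↔ a ∉ P ∧ a⁻¹ ∉ P)
    (hHP : ∀ h ∈ H, ∀ a ∈ P, h * a ∈ P ∧ a * h ∈ P)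
    (φ : H →* Multiplicative ℤ) (hCH : C ≤ H) (hφ : ∀ c (hc : c ∈ C), φ ⟨c, hCH hc⟩ = 1) :
    IsRelativeCone C (P ∪ {a | ∃ h : a ∈ H, 1 < φ ⟨a, h⟩}) := by
  have key : ∀ {a}, a ∈ P → a ∉ H := fun ha h => ((hH _).1 h).1 ha
  refine ⟨?_, ?_, (φ.ker).map H.subtype, ?_, ?_, ?_⟩
  · rintro (h | ⟨h, h1⟩)
    · exact hP.one_notMem h
    · exact absurd h1 (by rw [show (⟨1, h⟩ : H) = 1 from rfl, map_one]; exact lt_irrefl _)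
  · rintro a (ha | ⟨ha, ha'⟩) b (hb | ⟨hb, hb'⟩)
    · exact .inl (hP.mul_mem _ ha _ hb)
    · exact .inl (hHP b hb a ha).2
    · exact .inl (hHP a ha b hb).1
    · refine .inr ⟨H.mul_mem ha hb, ?_⟩
      rw [show (⟨a * b, H.mul_mem ha hb⟩ : H) = ⟨a, ha⟩ * ⟨b, hb⟩ from rfl, map_mul]
      exact one_lt_mul'' ha' hb'
  · intro c hc
    exact ⟨⟨c, hCH hc⟩, hφ c hc, rfl⟩
  · intro a
    constructor
    · rintro ⟨⟨a, ha⟩, hk, rfl⟩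
      have hk : φ ⟨a, ha⟩ = 1 := hk
      have hk' : φ ⟨a⁻¹, H.inv_mem ha⟩ = 1 := by
        rw [show (⟨a⁻¹, H.inv_mem ha⟩ : H) = ⟨a, ha⟩⁻¹ from rfl, map_inv, hk, inv_one]
      refine ⟨?_, ?_⟩
      · rintro (h | ⟨h, h1⟩)
        · exact key h ha
        · exact h1.ne' hk
      · rintro (h | ⟨h, h1⟩)
        · exact key h (H.inv_mem ha)
        · exact h1.ne' hk'
    · rintro ⟨h1, h2⟩
      have ha : a ∈ H := (hH a).2 ⟨fun h => h1 (.inl h), fun h => h2 (.inl h)⟩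
      refine ⟨⟨a, ha⟩, ?_, rfl⟩
      rcases lt_trichotomy (φ ⟨a, ha⟩) 1 with h | h | h
      · refine absurd (Or.inr ⟨H.inv_mem ha, ?_⟩) h2
        rw [show (⟨a⁻¹, H.inv_mem ha⟩ : H) = ⟨a, ha⟩⁻¹ from rfl, map_inv]
        exact one_lt_inv'.2 h
      · exact h
      · exact absurd (.inr ⟨ha, h⟩) h1
  · rintro _ ⟨⟨h, hh⟩, hk, rfl⟩ a (ha | ⟨ha, ha'⟩)
    · exact ⟨.inl (hHP h hh a ha).1, .inl (hHP h hh a ha).2⟩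
    · have hk : φ ⟨h, hh⟩ = 1 := hk
      refine ⟨.inr ⟨H.mul_mem hh ha, ?_⟩, .inr ⟨H.mul_mem ha hh, ?_⟩⟩
      · rw [show (⟨H.subtype ⟨h, hh⟩ * a, H.mul_mem hh ha⟩ : H) = ⟨h, hh⟩ * ⟨a, ha⟩ from rfl,
          map_mul, hk, one_mul]
        exact ha'
      · rw [show (⟨a * H.subtype ⟨h, hh⟩, H.mul_mem ha hh⟩ : H) = ⟨a, ha⟩ * ⟨h, hh⟩ from rfl,
          map_mul, hk, mul_one]
        exact ha'

/-- Order cosets by `aC < bC ↔ a⁻¹ * b ∈ P`. This is well defined because `C ≤ H` stabilizes `P` on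
both sides; `hC` gives trichotomy. -/
theorem IsRelativeCone.isLeftRelativelyConvex {G : Type*} [Group G] {C : Subgroup G} {P : Set G}
    (hP : IsRelativeCone C P) (hC : ∀ a, a ∉ P → a⁻¹ ∉ P → a ∈ C) :
    C.IsLeftRelativelyConvex := by
  obtain ⟨H, hCH, hH, hHP⟩ := hP.exists_subgroup
  have hinv : ∀ {a}, a ∈ P → a⁻¹ ∉ P := fun ha h =>
    hP.one_notMem (by simpa using hP.mul_mem _ ha _ h)
  let r : G ⧸ C → G ⧸ C → Prop := Quotient.lift₂ (fun a b => a⁻¹ * b ∈ P) (by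
    intro a b a' b' ha hb
    have ha : a⁻¹ * a' ∈ C := QuotientGroup.leftRel_apply.1 ha
    have hb : b⁻¹ * b' ∈ C := QuotientGroup.leftRel_apply.1 hb
    refine propext ⟨fun h => ?_, fun h => ?_⟩
    · have h1 := (hHP _ (hCH (C.inv_mem ha)) _ (hHP _ (hCH hb) _ h).2).1
      simpa [mul_assoc] using h1
    · have h1 := (hHP _ (hCH ha) _ (hHP _ (hCH (C.inv_mem hb)) _ h).2).1
      simpa [mul_assoc] using h1)
  have hr : ∀ a b : G, r a b ↔ a⁻¹ * b ∈ P := fun _ _ => Iff.rfl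
  refine ⟨r, { trichotomous := ?_, irrefl := ?_, trans := ?_ }, ?_⟩
  · intro a b
    induction a using QuotientGroup.induction_on with | _ a
    induction b using QuotientGroup.induction_on with | _ b
    rw [hr, hr]
    intro h1 h2
    exact QuotientGroup.eq.2 (hC _ h1 (by simpa using h2))
  · intro a
    induction a using QuotientGroup.induction_on with | _ a
    rw [hr]
    simpa using hP.one_notMem
  · intro a b c
    induction a using QuotientGroup.induction_on with | _ a
    induction b using QuotientGroup.induction_on with | _ b
    induction c using QuotientGroup.induction_on with | _ c
    rw [hr, hr, hr]
    intro h1 h2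
    simpa [mul_assoc] using hP.mul_mem _ h1 _ h2
  · intro g a b
    induction a using QuotientGroup.induction_on with | _ a
    induction b using QuotientGroup.induction_on with | _ b
    change r ((g * a : G) : G ⧸ C) ((g * b : G) : G ⧸ C) ↔ _
    rw [hr, hr]
    simp [mul_assoc]

/-- A Burns–Hale type criterion: `C` is left relatively convex if every subgroup properly containing
`C` has a nontrivial homomorphism to `ℤ` that kills `C`. -/
theorem Subgroup.isLeftRelativelyConvex_of_forall_exists_hom {G : Type*} [Group G]
    (C : Subgroup G) (h : ∀ H : Subgroup G, ∀ hCH : C < H, ∃ φ : H →* Multiplicative ℤ, φ ≠ 1 ∧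
      ∀ c (hc : c ∈ C), φ ⟨c, hCH.le hc⟩ = 1) : C.IsLeftRelativelyConvex := by
  obtain ⟨P, hP⟩ := zorn_subset {P : Set G | IsRelativeCone C P} fun c hc hchain =>
    ⟨⋃₀ c, IsRelativeCone.sUnion hc hchain, fun _ => Set.subset_sUnion_of_mem⟩
  have hcone : IsRelativeCone C P := hP.prop
  obtain ⟨H, hCH, hH, hHP⟩ := hcone.exists_subgroup
  refine hcone.isLeftRelativelyConvex fun a ha ha' => ?_
  have haH : a ∈ H := (hH a).2 ⟨ha, ha'⟩
  by_contra haC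
  have hlt : C < H := lt_of_le_of_ne hCH (by rintro rfl; exact haC haH)
  obtain ⟨φ, hφ, hφC⟩ := h H hlt
  -- By maximality `P` absorbs the elements of `H` where `φ` is positive, but `H` is disjoint from
  -- `P`.
  have hsub := hP.le_of_ge (hcone.union_hom hH hHP φ hCH hφC) Set.subset_union_left
  obtain ⟨⟨b, hb⟩, hφb⟩ : ∃ b, 1 < φ b := by
    by_contra! hle
    refine hφ (MonoidHom.ext fun b => le_antisymm (hle b) ?_)
    simpa using hle b⁻¹
  exact ((hH b).1 hb).1 (hsub (.inr ⟨hb, hφb⟩))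

/-! ### Homomorphisms to `ℤ` killing a given element -/

/-- Additively, `ψ(c)φ - φ(c)ψ` kills `c` and is nonzero at `s` unless `ψ(c) = 0`, when `ψ` itself
serves. -/
theorem exists_hom_int_ne_one_apply_eq_one {G : Type*} [Group G] (φ ψ : G →* Multiplicative ℤ)
    {s t : G} (hφs : φ s ≠ 1) (hψs : ψ s = 1) (hψt : ψ t ≠ 1) (c : G) :
    ∃ χ : G →* Multiplicative ℤ, χ ≠ 1 ∧ χ c = 1 := by
  by_cases hc : ψ c = 1
  · exact ⟨ψ, fun h => hψt (by simp [h]), hc⟩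
  · refine ⟨φ ^ (ψ c).toAdd * ψ ^ (-(φ c).toAdd), fun h => ?_, ?_⟩
    · have h1 := DFunLike.congr_fun h s
      apply_fun Multiplicative.toAdd at h1
      rcases (by simpa [hψs] using h1) with h2 | h2
      · exact hc h2
      · exact hφs h2
    · apply Multiplicative.toAdd.injective
      simp [mul_comm]

theorem FreeGroup.isCyclic_of_subsingleton (ι : Type*) [Subsingleton ι] :
    IsCyclic (FreeGroup ι) := by
  rcases isEmpty_or_nonempty ι with h | ⟨⟨i⟩⟩
  · infer_instance
  · refine ⟨FreeGroup.of i, fun x => ?_⟩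
    induction x using FreeGroup.induction_on with
    | C1 => exact one_mem (Subgroup.zpowers (FreeGroup.of i))
    | of j => exact Subsingleton.elim i j ▸ Subgroup.mem_zpowers _
    | inv_of j hj => exact (Subgroup.zpowers (FreeGroup.of i)).inv_mem hj
    | mul x y hx hy => exact (Subgroup.zpowers (FreeGroup.of i)).mul_mem hx hy

theorem IsFreeGroup.exists_hom_int {G : Type*} [Group G] [IsFreeGroup G] (hG : ¬ IsCyclic G)
    (c : G) : ∃ χ : G →* Multiplicative ℤ, χ ≠ 1 ∧ χ c = 1 := by
  classical
  have hnt : Nontrivial (Generators G) := by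
    by_contra h
    rw [not_nontrivial_iff_subsingleton] at h
    have := FreeGroup.isCyclic_of_subsingleton (Generators G)
    exact hG (isCyclic_of_surjective (mulEquiv G) (mulEquiv G).surjective)
  obtain ⟨i, j, hij⟩ := exists_pair_ne (Generators G)
  have key : ∀ i j : Generators G,
      IsFreeGroup.lift (Pi.mulSingle i (Multiplicative.ofAdd (1 : ℤ))) (of j) =
        Pi.mulSingle (M := fun _ => Multiplicative ℤ) i (Multiplicative.ofAdd (1 : ℤ)) j :=
    fun i j => lift_of _ _
  refine exists_hom_int_ne_one_apply_eq_one (IsFreeGroup.lift (Pi.mulSingle i (.ofAdd (1 : ℤ))))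
    (IsFreeGroup.lift (Pi.mulSingle j (.ofAdd (1 : ℤ)))) (s := of i) (t := of j) ?_ ?_ ?_ c
  · rw [key, Pi.mulSingle_eq_same]; decide
  · rw [key, Pi.mulSingle_eq_of_ne hij]
  · rw [key, Pi.mulSingle_eq_same]; decide
-- Free action groupoids of presented groups
/-- A recursion along the orbits of a permutation has a unique solution with prescribed values on a
transversal of the orbits. -/
theorem Equiv.Perm.existsUnique_recursion {A X : Type*} (σ : Equiv.Perm A) (B : Set A)
    (hB : ∀ a : A, ∃! p : ℤ × B, (σ ^ p.1) p.2 = a) (T : A → Equiv.Perm X) (i : A → X) :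
    ∃! f : A → X, (∀ a, f (σ a) = T a (f a)) ∧ ∀ b ∈ B, f b = i b := by
  -- Skew product over `σ`: solutions of the recursion are the functions whose graph is
  -- `S`-invariant.
  let S : Equiv.Perm (A × X) :=
    { toFun := fun p => (σ p.1, T p.1 p.2)
      invFun := fun p => (σ⁻¹ p.1, (T (σ⁻¹ p.1))⁻¹ p.2)
      left_inv := fun p => by simp
      right_inv := fun p => by simp }
  have hS1 : ∀ p, (S p).1 = σ p.1 := fun _ => rfl
  have hS : ∀ (k : ℤ) (p : A × X), ((S ^ k) p).1 = (σ ^ k) p.1 := by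
    intro k
    induction k with
    | zero => simp
    | succ k ih =>
      intro p
      rw [zpow_add_one, zpow_add_one, Equiv.Perm.mul_apply, Equiv.Perm.mul_apply, ih, hS1]
    | pred k ih =>
      intro p
      rw [zpow_sub_one, zpow_sub_one, Equiv.Perm.mul_apply, Equiv.Perm.mul_apply, ih]
      rfl
  choose p hp hpu using hB
  have hpσ : ∀ a, p (σ a) = ((p a).1 + 1, (p a).2) := fun a =>
    (hpu (σ a) ((p a).1 + 1, (p a).2) (by
      change (σ ^ ((p a).1 + 1)) ((p a).2 : A) = _
      rw [add_comm, zpow_add, zpow_one, Equiv.Perm.mul_apply]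
      exact congrArg σ (hp a))).symm
  refine ⟨fun a => ((S ^ (p a).1) ((p a).2, i (p a).2)).2, ⟨fun a => ?_, fun b hb => ?_⟩, ?_⟩
  · simp only [hpσ]
    rw [add_comm, zpow_add, zpow_one, Equiv.Perm.mul_apply]
    change T _ _ = _
    rw [hS]
    exact congrArg (fun c => T c _) (hp a)
  · have : p b = (0, ⟨b, hb⟩) := (hpu b (0, ⟨b, hb⟩) (by simp)).symm
    simp [this]
  · rintro f ⟨hf, hfB⟩
    have hSf : ∀ (k : ℤ) (a : A), (S ^ k) (a, f a) = ((σ ^ k) a, f ((σ ^ k) a)) := by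
      have h1 : ∀ a, S (a, f a) = (σ a, f (σ a)) := fun a => Prod.ext rfl (hf a).symm
      intro k
      induction k with
      | zero => simp
      | succ k ih =>
        intro a
        rw [zpow_add_one, zpow_add_one, Equiv.Perm.mul_apply, Equiv.Perm.mul_apply, h1, ih]
      | pred k ih =>
        intro a
        have h2 : S⁻¹ (a, f a) = (σ⁻¹ a, f (σ⁻¹ a)) := by
          rw [Equiv.Perm.inv_eq_iff_eq, h1]; simp
        rw [zpow_sub_one, zpow_sub_one, Equiv.Perm.mul_apply, Equiv.Perm.mul_apply, h2, ih]
    funext a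
    rw [← hfB _ (p a).2.2, hSf]
    exact congrArg f (hp a).symm

open CategoryTheory SemidirectProduct in
/-- The relators hold in a semidirect product `(A → X) ⋊ Γ`, for generators of the form
`c e = (f e, e)`, exactly when the coordinate `f x` satisfies a recursion along the orbits of `g`
in `A`. -/
def PresentedGroup.IsRecursiveGenerator {α : Type} [DecidableEq α] (rels : Set (FreeGroup α))
    (x : α) (g : PresentedGroup rels) : Prop :=
  ∀ (A X : Type) [MulAction (PresentedGroup rels) A] [Group X]
    (c : α → (A → X) ⋊[mulAutArrow] (PresentedGroup rels)),
    (∀ e, (c e).right = PresentedGroup.of e) → ∃ T : A → Equiv.Perm X, ∀ f : A → X,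
      (∀ r ∈ rels, FreeGroup.lift (Function.update c x ⟨f, PresentedGroup.of x⟩) r = 1) ↔
        ∀ a, f (g • a) = T a (f a)

open CategoryTheory CategoryTheory.ActionCategory SemidirectProduct in
/-- If `x` is a recursive generator along `g`, and the orbits of `g` in `A` have a transversal, then
the action groupoid of the presented group on `A` is free. -/
theorem PresentedGroup.IsRecursiveGenerator.nonempty_isFreeGroupoid {α A : Type}
    {rels : Set (FreeGroup α)} [DecidableEq α] [MulAction (PresentedGroup rels) A] {x : α}
    {g : PresentedGroup rels} (hrec : IsRecursiveGenerator rels x g) (B : Set A)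
    (hB : ∀ a : A, ∃! p : ℤ × B, (MulAction.toPerm g ^ p.1 : Equiv.Perm A) p.2 = a) :
    Nonempty (IsFreeGroupoid (ActionCategory (PresentedGroup rels) A)) := by
  classical
  refine ⟨{
    -- All edges of the Schreier graph, except that an edge labelled `x` is kept only if it ends in
    -- `B`.
    quiverGenerators := ⟨fun a b => { e : α //
      (PresentedGroup.of e : PresentedGroup rels) • a.back = b.back ∧ (e = x → b.back ∈ B) }⟩
    of := fun (e : Subtype _) => ⟨PresentedGroup.of e, e.property.1⟩
    unique_lift := ?_ }⟩
  intro X _ f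
  let c : α → (A → X) ⋊[mulAutArrow] (PresentedGroup rels) := fun e =>
    ⟨fun b => if h : e = x → b ∈ B then
      @f ⟨(), _⟩ ⟨(), b⟩ ⟨e, smul_inv_smul _ b, h⟩ else 1, PresentedGroup.of e⟩
  obtain ⟨T, hT⟩ := hrec A X c fun e => rfl
  obtain ⟨f₀, ⟨hf₀, hf₀B⟩, hf₀u⟩ :=
    (MulAction.toPerm g : Equiv.Perm A).existsUnique_recursion B hB T (c x).left
  let F' := PresentedGroup.toGroup ((hT f₀).2 hf₀)
  have hF' : ∀ e, F' (PresentedGroup.of e) = Function.update c x ⟨f₀, PresentedGroup.of x⟩ e :=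
    fun e => PresentedGroup.toGroup.of _
  have hFright : ∀ e, (F' (PresentedGroup.of e)).right = PresentedGroup.of e := by
    intro e
    rw [hF']
    rcases eq_or_ne e x with rfl | h
    · rw [Function.update_self]
    · rw [Function.update_of_ne h]
  have hFleft : ∀ e b, (e = x → b ∈ B) → (F' (PresentedGroup.of e)).left b = (c e).left b := by
    intro e b h
    rw [hF']
    rcases eq_or_ne e x with rfl | h'
    · rw [Function.update_self]; exact hf₀B b (h rfl)
    · rw [Function.update_of_ne h']
  -- Functors from the action groupoid to `X` are homomorphisms to the semidirect product that lift
  -- the identity.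
  refine ⟨uncurry F' ?_, ?_, ?_⟩
  · suffices SemidirectProduct.rightHom.comp F' = MonoidHom.id _ by
      exact DFunLike.ext_iff.mp this
    exact PresentedGroup.ext hFright
  · rintro ⟨⟨⟩, a : A⟩ ⟨⟨⟩, b : A⟩ ⟨e, h : PresentedGroup.of e • a = b, hx⟩
    change (F' (PresentedGroup.of e)).left b = _
    rw [hFleft e b hx]
    cases inv_smul_eq_iff.mpr h.symm
    exact dif_pos hx
  · intro E hE
    have hcE : ∀ e b, (e = x → b ∈ B) →
        (curry E (PresentedGroup.of e)).left b = (c e).left b := by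
      intro e b h
      refine Eq.trans ?_ (dif_pos h).symm
      exact hE (objEquiv _ A ((PresentedGroup.of e)⁻¹ • b)) (objEquiv _ A b) ⟨e, smul_inv_smul _ b, h⟩
    have hup : ∀ e, Function.update c x
        ⟨(curry E (PresentedGroup.of x)).left, PresentedGroup.of x⟩ e =
          curry E (PresentedGroup.of e) := by
      intro e
      rcases eq_or_ne e x with rfl | h
      · rw [Function.update_self]; rfl
      · rw [Function.update_of_ne h]
        refine SemidirectProduct.ext ?_ rfl
        funext b
        exact (hcE e b fun h' => absurd h' h).symm
    -- `curry E` respects the relators, so its `x`-coordinate solves the same recursion.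
    have hleft : (curry E (PresentedGroup.of x)).left = f₀ := by
      refine hf₀u _ ⟨(hT _).1 fun r hr => ?_, fun b hb => hcE x b fun _ => hb⟩
      have : FreeGroup.lift (Function.update c x
          ⟨(curry E (PresentedGroup.of x)).left, PresentedGroup.of x⟩) =
            (curry E).comp (PresentedGroup.mk rels) :=
        FreeGroup.ext_hom _ _ fun e => by rw [FreeGroup.lift_apply_of, hup]; rfl
      rw [this, MonoidHom.comp_apply, PresentedGroup.one_of_mem hr, map_one]
    have : curry E = F' := by
      refine PresentedGroup.ext fun e => ?_
      rw [hF', ← hup, hleft]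
    apply Functor.hext
    · intro
      apply Unit.ext
    · refine ActionCategory.cases ?_
      intro t g
      refine heq_of_eq ?_
      change (curry E g).left t = (F' g).left t
      rw [this]

open CategoryTheory CategoryTheory.ActionCategory in
-- Stabilizers are the vertex groups of the action groupoid, and a connected free groupoid has free
-- vertex groups.
theorem MulAction.isFreeGroup_stabilizer {G A : Type} [Group G] [MulAction G A]
    [MulAction.IsPretransitive G A] [IsFreeGroupoid (ActionCategory G A)] (a : A) :
    IsFreeGroup (MulAction.stabilizer G a) := by
  have : Nonempty A := ⟨a⟩
  have hc : IsConnected (ActionCategory G A) := inferInstance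
  have h := @IsFreeGroupoid.endIsFreeOfConnectedFree (ActionCategory G A) _ hc _ (objEquiv G A a)
  exact @IsFreeGroup.ofMulEquiv _ _ h _ _
    { toFun := fun f => ⟨f.1, f.2⟩
      invFun := fun f => ⟨f.1, f.2⟩
      left_inv := fun _ => rfl
      right_inv := fun _ => rfl
      map_mul' := fun _ _ => rfl }

/-! ### Relators in which a generator occurs twice -/

open SemidirectProduct in
theorem PresentedGroup.right_lift {α A X : Type} {rels : Set (FreeGroup α)}
    [MulAction (PresentedGroup rels) A] [Group X]
    {c : α → (A → X) ⋊[mulAutArrow] (PresentedGroup rels)}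
    (hc : ∀ e, (c e).right = PresentedGroup.of e) (w : FreeGroup α) :
    (FreeGroup.lift c w).right = PresentedGroup.mk rels w := by
  have : rightHom.comp (FreeGroup.lift c) = PresentedGroup.mk rels :=
    FreeGroup.ext_hom _ _ fun e => by
      rw [MonoidHom.comp_apply, FreeGroup.lift_apply_of]; exact hc e
  exact DFunLike.congr_fun this w

theorem FreeGroup.lift_update_of_mem_closure {α G : Type*} [DecidableEq α] [Group G] {x : α}
    {u : FreeGroup α} (hu : u ∈ Subgroup.closure (FreeGroup.of '' {x}ᶜ)) (c : α → G) (y : G) :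
    FreeGroup.lift (Function.update c x y) u = FreeGroup.lift c u := by
  refine MonoidHom.eqOn_closure (s := FreeGroup.of '' {x}ᶜ) ?_ hu
  rintro _ ⟨e, he, rfl⟩
  rw [FreeGroup.lift_apply_of, FreeGroup.lift_apply_of, Function.update_of_ne he]

theorem MonoidHom.apply_eq_one_iff_of_conj {G H : Type*} [Group G] [Group H] (φ : G →* H)
    {p r s : G} (h : p * r * p⁻¹ = s) : φ r = 1 ↔ φ s = 1 := by
  rw [← h]; simp

theorem PresentedGroup.update_right {α A X : Type} [DecidableEq α] {rels : Set (FreeGroup α)}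
    [MulAction (PresentedGroup rels) A] [Group X]
    {c : α → (A → X) ⋊[mulAutArrow] (PresentedGroup rels)}
    (hc : ∀ e, (c e).right = PresentedGroup.of e) (x : α) (f : A → X) (e : α) :
    (Function.update c x ⟨f, PresentedGroup.of x⟩ e).right = PresentedGroup.of e := by
  rcases eq_or_ne e x with rfl | h
  · rw [Function.update_self]
  · rw [Function.update_of_ne h, hc]

/-- The right component is trivial automatically, since the relator already holds in the presented
group. -/
theorem PresentedGroup.lift_relator_eq_one_iff {α A X : Type} {r : FreeGroup α}
    [MulAction (PresentedGroup {r}) A] [Group X]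
    {c : α → (A → X) ⋊[mulAutArrow] (PresentedGroup {r})}
    (hc : ∀ e, (c e).right = PresentedGroup.of e) {p s : FreeGroup α} (h : p * r * p⁻¹ = s) :
    (∀ r' ∈ ({r} : Set (FreeGroup α)), FreeGroup.lift c r' = 1) ↔
      ∀ a, (FreeGroup.lift c s).left a = 1 := by
  have hs : (FreeGroup.lift c s).right = 1 := by
    rw [PresentedGroup.right_lift hc, ← (PresentedGroup.mk {r}).apply_eq_one_iff_of_conj h]
    exact PresentedGroup.one_of_mem rfl
  simp only [Set.mem_singleton_iff, forall_eq, (FreeGroup.lift c).apply_eq_one_iff_of_conj h]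
  constructor
  · intro h a; rw [h]; rfl
  · intro h; exact SemidirectProduct.ext (funext h) hs

/-- Read at the vertex `xu • a`, the relation is `f (xu • a) * U * f a * V = 1`, which can be solved
for `f (xu • a)`. -/
theorem PresentedGroup.isRecursiveGenerator_of_same_sign {α : Type} [DecidableEq α]
    {r p u v : FreeGroup α} {x : α} (hu : u ∈ Subgroup.closure (FreeGroup.of '' {x}ᶜ))
    (hv : v ∈ Subgroup.closure (FreeGroup.of '' {x}ᶜ))
    (h : p * r * p⁻¹ = FreeGroup.of x * u * FreeGroup.of x * v) :
    IsRecursiveGenerator {r} x (PresentedGroup.mk {r} (FreeGroup.of x * u)) := by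
  intro A X _ _ c hc
  let U := (FreeGroup.lift c u).left
  let V := (FreeGroup.lift c v).left
  let gx : PresentedGroup {r} := PresentedGroup.of x
  let gu : PresentedGroup {r} := PresentedGroup.mk {r} u
  refine ⟨fun a => ((Equiv.mulLeft (U (gu • a))).trans (Equiv.mulRight (V (gx⁻¹ • a)))).trans
    (Equiv.inv X), fun f => ?_⟩
  have key : ∀ a, (FreeGroup.lift (Function.update c x ⟨f, PresentedGroup.of x⟩)
      (FreeGroup.of x * u * FreeGroup.of x * v)).left a =
      f a * U (gx⁻¹ • a) * f (gu⁻¹ • gx⁻¹ • a) * V (gx⁻¹ • gu⁻¹ • gx⁻¹ • a) := by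
    intro a
    simp only [map_mul, SemidirectProduct.mul_left, SemidirectProduct.mul_right,
      FreeGroup.lift_update_of_mem_closure hu, FreeGroup.lift_update_of_mem_closure hv,
      FreeGroup.lift_apply_of, Function.update_self, PresentedGroup.right_lift hc]
    rfl
  rw [PresentedGroup.lift_relator_eq_one_iff (PresentedGroup.update_right hc x f) h]
  simp only [key]
  rw [← (MulAction.toPerm (gx * gu) : Equiv.Perm A).forall_congr_right]
  refine forall_congr' fun a => ?_
  change _ ↔ f ((gx * gu) • a) = (U (gu • a) * f a * V (gx⁻¹ • a))⁻¹
  rw [← mul_eq_one_iff_eq_inv]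
  simp [mul_assoc, mul_smul]

/-- Read at `x⁻¹u • a`, the relation is `(f (u • a))⁻¹ * U * f a * V = 1`: the shifts by `x` cancel,
leaving a recursion along `u`. -/
theorem PresentedGroup.isRecursiveGenerator_of_opposite_sign {α : Type} [DecidableEq α]
    {r p u v : FreeGroup α} {x : α} (hu : u ∈ Subgroup.closure (FreeGroup.of '' {x}ᶜ))
    (hv : v ∈ Subgroup.closure (FreeGroup.of '' {x}ᶜ))
    (h : p * r * p⁻¹ = (FreeGroup.of x)⁻¹ * u * FreeGroup.of x * v) :
    IsRecursiveGenerator {r} x (PresentedGroup.mk {r} u) := by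
  intro A X _ _ c hc
  let U := (FreeGroup.lift c u).left
  let V := (FreeGroup.lift c v).left
  let gx : PresentedGroup {r} := PresentedGroup.of x
  let gu : PresentedGroup {r} := PresentedGroup.mk {r} u
  refine ⟨fun a => (Equiv.mulLeft (U (gu • a))).trans (Equiv.mulRight (V (gx⁻¹ • a))),
    fun f => ?_⟩
  have key : ∀ a, (FreeGroup.lift (Function.update c x ⟨f, PresentedGroup.of x⟩)
      ((FreeGroup.of x)⁻¹ * u * FreeGroup.of x * v)).left a =
      (f (gx⁻¹⁻¹ • a))⁻¹ * U (gx⁻¹⁻¹ • a) * f (gu⁻¹ • gx⁻¹⁻¹ • a) *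
        V (gx⁻¹ • gu⁻¹ • gx⁻¹⁻¹ • a) := by
    intro a
    simp only [map_mul, map_inv, SemidirectProduct.mul_left, SemidirectProduct.mul_right,
      SemidirectProduct.inv_left, SemidirectProduct.inv_right,
      FreeGroup.lift_update_of_mem_closure hu, FreeGroup.lift_update_of_mem_closure hv,
      FreeGroup.lift_apply_of, Function.update_self, PresentedGroup.right_lift hc]
    rfl
  rw [PresentedGroup.lift_relator_eq_one_iff (PresentedGroup.update_right hc x f) h]
  simp only [key]
  rw [← (MulAction.toPerm (gx⁻¹ * gu) : Equiv.Perm A).forall_congr_right]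
  refine forall_congr' fun a => ?_
  change _ ↔ f (gu • a) = U (gu • a) * f a * V (gx⁻¹ • a)
  rw [← inv_mul_eq_one (a := f (gu • a))]
  simp [mul_assoc, mul_smul]

/-! ### Free kernels of homomorphisms to `ℤ` -/

theorem Multiplicative.existsUnique_zpow_mulLeft {d : ℤ} (hd : d ≠ 0) (a : Multiplicative ℤ) :
    ∃! p : ℤ × {b : Multiplicative ℤ | 0 ≤ b.toAdd ∧ b.toAdd < |d|},
      (Equiv.mulLeft (Multiplicative.ofAdd d) ^ p.1 : Equiv.Perm (Multiplicative ℤ)) p.2 = a := by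
  have key : ∀ (k : ℤ) (b : Multiplicative ℤ),
      ((Equiv.mulLeft (Multiplicative.ofAdd d) ^ k : Equiv.Perm (Multiplicative ℤ)) b).toAdd =
        b.toAdd + d * k := by
    intro k b
    rw [Equiv.zpow_mulLeft]
    simp [mul_comm, add_comm]
  refine ⟨(a.toAdd / d, ⟨.ofAdd (a.toAdd % d), Int.emod_nonneg _ hd, Int.emod_lt_abs _ hd⟩),
    Multiplicative.toAdd.injective ?_, ?_⟩
  · rw [key]; exact Int.emod_add_mul_ediv _ _
  · rintro ⟨k, b, hb0, hb⟩ h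
    have h := congrArg Multiplicative.toAdd h
    rw [key] at h
    have h1 : a.toAdd / d = k ∧ a.toAdd % d = b.toAdd := by
      rw [← h]
      constructor
      · rw [Int.add_mul_ediv_left _ _ hd, Int.ediv_eq_zero_of_lt_abs hb0 hb, zero_add]
      · rw [Int.add_mul_emod_self_left, ← Int.emod_abs, Int.emod_eq_of_lt hb0 hb]
    refine Prod.ext h1.1.symm (Subtype.ext ?_)
    exact Multiplicative.toAdd.injective h1.2.symm

/-- The image is infinite cyclic; rescaling makes the translation action on `ℤ` transitive without
changing the kernel. -/
theorem MonoidHom.exists_surjective_int {G : Type*} [Group G] {ψ : G →* Multiplicative ℤ}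
    (hψ : ψ ≠ 1) :
    ∃ χ : G →* Multiplicative ℤ, Function.Surjective χ ∧ ∀ y, χ y = 1 ↔ ψ y = 1 := by
  obtain ⟨g, hg⟩ : ∃ g, ψ g ≠ 1 := by
    by_contra! h
    exact hψ (MonoidHom.ext h)
  have hinf : Infinite ψ.range := by
    refine Infinite.of_injective (fun n : ℤ => (⟨ψ g ^ n, g ^ n, map_zpow _ _ _⟩ : ψ.range)) ?_
    intro m n h
    have h := congrArg Multiplicative.toAdd (congrArg Subtype.val h)
    exact mul_right_cancel₀ (b := (ψ g).toAdd) (fun h' => hg h') (by simpa using h)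
  let e : ψ.range ≃* Multiplicative ℤ :=
    mulEquivOfCyclicCardEq (by rw [Nat.card_eq_zero_of_infinite, Nat.card_eq_zero_of_infinite])
  exact ⟨e.toMonoidHom.comp ψ.rangeRestrict, e.surjective.comp ψ.rangeRestrict_surjective,
    fun y => e.map_eq_one_iff.trans (by rw [Subtype.ext_iff]; rfl)⟩

/-- If `x` is a recursive generator along `g`, then every homomorphism to `ℤ` that does not kill `g`
has a free kernel. -/
theorem PresentedGroup.IsRecursiveGenerator.isFreeGroup_ker {α : Type}
    {rels : Set (FreeGroup α)} [DecidableEq α] {x : α} {g : PresentedGroup rels}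
    (hrec : IsRecursiveGenerator rels x g) (ψ : PresentedGroup rels →* Multiplicative ℤ)
    (hψ : ψ g ≠ 1) : IsFreeGroup ψ.ker := by
  obtain ⟨χ, hχs, hχ1⟩ := MonoidHom.exists_surjective_int (ψ := ψ) fun h => hψ (by simp [h])
  let _ : MulAction (PresentedGroup rels) (Multiplicative ℤ) := MulAction.compHom _ χ
  have hsmul : ∀ (y : PresentedGroup rels) (n : Multiplicative ℤ), y • n = χ y * n :=
    fun _ _ => rfl
  have : MulAction.IsPretransitive (PresentedGroup rels) (Multiplicative ℤ) := ⟨fun a b => by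
    obtain ⟨y, hy⟩ := hχs (b * a⁻¹)
    exact ⟨y, by rw [hsmul, hy, inv_mul_cancel_right]⟩⟩
  have hd : (χ g).toAdd ≠ 0 := fun h => hψ ((hχ1 g).1 h)
  have hperm : (MulAction.toPerm g : Equiv.Perm (Multiplicative ℤ)) =
      Equiv.mulLeft (Multiplicative.ofAdd (χ g).toAdd) := Equiv.ext fun n => hsmul g n
  obtain ⟨_⟩ := hrec.nonempty_isFreeGroupoid (A := Multiplicative ℤ) _
    (by rw [hperm]; exact Multiplicative.existsUnique_zpow_mulLeft hd)
  have hfree := MulAction.isFreeGroup_stabilizer (G := PresentedGroup rels) (1 : Multiplicative ℤ)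
  have hker : MulAction.stabilizer (PresentedGroup rels) (1 : Multiplicative ℤ) = ψ.ker := by
    ext y
    rw [MulAction.mem_stabilizer_iff, hsmul, mul_one, hχ1, MonoidHom.mem_ker]
  rwa [hker] at hfree

/-! ### Surface groups -/

theorem List.exists_prod_ofFn_eq {G : Type*} [Group G] {n : ℕ} (f : Fin n → G) (i : Fin n) :
    ∃ a ∈ Subgroup.closure (f '' {i}ᶜ), ∃ b ∈ Subgroup.closure (f '' {i}ᶜ),
      (List.ofFn f).prod = a * f i * b := by
  have hmem : ∀ l : List (Fin n), i ∉ l → (l.map f).prod ∈ Subgroup.closure (f '' {i}ᶜ) := by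
    intro l hl
    refine Subgroup.list_prod_mem _ fun y hy => ?_
    obtain ⟨j, hj, rfl⟩ := List.mem_map.1 hy
    exact Subgroup.subset_closure ⟨j, fun h => hl (h ▸ hj), rfl⟩
  obtain ⟨s, t, hst⟩ := List.append_of_mem (List.mem_finRange i)
  have hnd := List.nodup_finRange n
  rw [hst, List.nodup_append, List.nodup_cons] at hnd
  refine ⟨_, hmem s fun h => hnd.2.2 i h i (by simp) rfl, _, hmem t hnd.2.1.1, ?_⟩
  rw [List.ofFn_eq_map, hst]
  simp [mul_assoc]

/-- Maximal cyclic subgroups are left relatively convex in a group in which every element is killed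
by a nontrivial homomorphism to `ℤ`, and in which these homomorphisms have free kernels. -/
theorem Subgroup.IsMaximalCyclic.isLeftRelativelyConvex_of_isFreeGroup_ker {G S : Type*} [Group G]
    [Group S] (e : G ≃* S) (hS : ∀ c : S, ∃ χ : S →* Multiplicative ℤ, χ ≠ 1 ∧ χ c = 1)
    (hfree : ∀ χ : S →* Multiplicative ℤ, χ ≠ 1 → IsFreeGroup χ.ker) {C : Subgroup G}
    (hC : C.IsMaximalCyclic) : C.IsLeftRelativelyConvex := by
  refine C.isLeftRelativelyConvex_of_forall_exists_hom fun H hCH => ?_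
  obtain ⟨⟨c, hcC⟩, hc⟩ := hC.prop.exists_generator
  suffices ∃ φ : H →* Multiplicative ℤ, φ ≠ 1 ∧ φ ⟨c, hCH.le hcC⟩ = 1 by
    obtain ⟨φ, hφ, hφc⟩ := this
    refine ⟨φ, hφ, fun a ha => ?_⟩
    obtain ⟨n, hn⟩ := hc ⟨a, ha⟩
    have : (⟨a, hCH.le ha⟩ : H) = ⟨c, hCH.le hcC⟩ ^ n :=
      Subtype.ext (congrArg Subtype.val hn).symm
    rw [this, map_zpow, hφc, one_zpow]
  obtain ⟨χ, hχ, hχc⟩ := hS (e c)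
  by_cases hH : (χ.comp e.toMonoidHom).comp H.subtype = 1
  · have hle : H.map e.toMonoidHom ≤ χ.ker := by
      rintro _ ⟨h, hh, rfl⟩
      exact DFunLike.congr_fun hH ⟨h, hh⟩
    have := hfree χ hχ
    have : IsFreeGroup H := IsFreeGroup.ofMulEquiv ((Subgroup.subgroupOfEquivOfLe hle).trans
      (H.equivMapOfInjective e.toMonoidHom e.injective).symm)
    -- A cyclic `H` would contradict the maximality of `C`.
    exact IsFreeGroup.exists_hom_int (fun hcyc => hCH.not_ge (hC.le_of_ge hcyc hCH.le)) _
  · exact ⟨_, hH, hχc⟩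

theorem Subgroup.IsMaximalCyclic.isLeftRelativelyConvex_of_isCyclic {G : Type*} [Group G]
    [IsCyclic G] {C : Subgroup G} (hC : C.IsMaximalCyclic) : C.IsLeftRelativelyConvex := by
  have h : C = ⊤ := top_le_iff.1 (hC.le_of_ge
    (isCyclic_of_surjective Subgroup.topEquiv.symm Subgroup.topEquiv.symm.surjective) le_top)
  exact C.isLeftRelativelyConvex_of_forall_exists_hom fun H hCH => absurd (h ▸ hCH) not_top_lt

theorem PresentedGroup.exists_of_ne_one {α H : Type*} [Group H] {rels : Set (FreeGroup α)}
    {ψ : PresentedGroup rels →* H} (hψ : ψ ≠ 1) : ∃ x : α, ψ (PresentedGroup.of x) ≠ 1 := by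
  by_contra! h
  exact hψ (PresentedGroup.ext h)

/-- For a generator `xᵢ` not killed by `ψ`, the relator is conjugate to `xᵢ * 1 * xᵢ * v`, giving a
recursion along `xᵢ`. -/
theorem NonorientableSurfaceGroup.isFreeGroup_ker {k : ℕ}
    {ψ : NonorientableSurfaceGroup k →* Multiplicative ℤ} (hψ : ψ ≠ 1) : IsFreeGroup ψ.ker := by
  obtain ⟨i, hi⟩ := PresentedGroup.exists_of_ne_one hψ
  obtain ⟨a, ha, b, hb, hab⟩ :=
    List.exists_prod_ofFn_eq (fun i : Fin k => FreeGroup.of i ^ 2) i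
  have hle : Subgroup.closure ((fun i : Fin k => FreeGroup.of i ^ 2) '' {i}ᶜ) ≤
      Subgroup.closure (FreeGroup.of '' {i}ᶜ) := by
    rw [Subgroup.closure_le]
    rintro _ ⟨j, hj, rfl⟩
    have hmem : FreeGroup.of j ∈ Subgroup.closure (FreeGroup.of '' {i}ᶜ) :=
      Subgroup.subset_closure ⟨j, hj, rfl⟩
    exact pow_mem hmem 2
  have h : a⁻¹ * nonorientableRelator k * a⁻¹⁻¹ =
      FreeGroup.of i * 1 * FreeGroup.of i * (b * a) := by
    rw [nonorientableRelator, hab]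
    simp only [sq]
    group
  refine (PresentedGroup.isRecursiveGenerator_of_same_sign (one_mem _)
    (mul_mem (hle hb) (hle ha)) h).isFreeGroup_ker ψ ?_
  rwa [mul_one]

/-- If `ψ` does not kill a generator, its partner in the commutator is the one to eliminate: the
recursion runs along the surviving generator or its inverse. -/
theorem OrientableSurfaceGroup.isFreeGroup_ker {g : ℕ}
    {ψ : OrientableSurfaceGroup g →* Multiplicative ℤ} (hψ : ψ ≠ 1) : IsFreeGroup ψ.ker := by
  obtain ⟨e, he⟩ := PresentedGroup.exists_of_ne_one hψ
  obtain ⟨i, hi⟩ : ∃ i, e = Sum.inl i ∨ e = Sum.inr i := by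
    rcases e with i | i
    exacts [⟨i, .inl rfl⟩, ⟨i, .inr rfl⟩]
  let r : Fin g → FreeGroup (Fin g ⊕ Fin g) := fun i =>
    (FreeGroup.of (Sum.inl i))⁻¹ * (FreeGroup.of (Sum.inr i))⁻¹ *
      FreeGroup.of (Sum.inl i) * FreeGroup.of (Sum.inr i)
  obtain ⟨a, ha, b, hb, hab⟩ := List.exists_prod_ofFn_eq r i
  have hmem : ∀ {e e' : Fin g ⊕ Fin g}, e' ≠ e →
      FreeGroup.of e' ∈ Subgroup.closure (FreeGroup.of '' {e}ᶜ) :=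
    fun h => Subgroup.subset_closure ⟨_, h, rfl⟩
  have hle : ∀ e : Fin g ⊕ Fin g, e = Sum.inl i ∨ e = Sum.inr i →
      Subgroup.closure (r '' {i}ᶜ) ≤ Subgroup.closure (FreeGroup.of '' {e}ᶜ) := by
    intro e he
    rw [Subgroup.closure_le]
    rintro _ ⟨j, hj, rfl⟩
    have h1 : FreeGroup.of (Sum.inl j) ∈ Subgroup.closure (FreeGroup.of '' {e}ᶜ) :=
      hmem (by rcases he with rfl | rfl <;> simp [show j ≠ i from hj])
    have h2 : FreeGroup.of (Sum.inr j) ∈ Subgroup.closure (FreeGroup.of '' {e}ᶜ) :=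
      hmem (by rcases he with rfl | rfl <;> simp [show j ≠ i from hj])
    exact mul_mem (mul_mem (mul_mem (inv_mem h1) (inv_mem h2)) h1) h2
  have hab : orientableRelator g = a * r i * b := hab
  rcases hi with rfl | rfl
  · have h : (a * (FreeGroup.of (Sum.inl i))⁻¹)⁻¹ * orientableRelator g *
        (a * (FreeGroup.of (Sum.inl i))⁻¹)⁻¹⁻¹ = (FreeGroup.of (Sum.inr i))⁻¹ *
          FreeGroup.of (Sum.inl i) * FreeGroup.of (Sum.inr i) *
            (b * a * (FreeGroup.of (Sum.inl i))⁻¹) := by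
      rw [hab]; simp only [r]; group
    exact (PresentedGroup.isRecursiveGenerator_of_opposite_sign (hmem (by simp))
      (mul_mem (mul_mem (hle _ (.inr rfl) hb) (hle _ (.inr rfl) ha)) (inv_mem (hmem (by simp))))
      h).isFreeGroup_ker ψ he
  · have h : a⁻¹ * orientableRelator g * a⁻¹⁻¹ = (FreeGroup.of (Sum.inl i))⁻¹ *
          (FreeGroup.of (Sum.inr i))⁻¹ * FreeGroup.of (Sum.inl i) *
            (FreeGroup.of (Sum.inr i) * b * a) := by
      rw [hab]; simp only [r]; group
    refine (PresentedGroup.isRecursiveGenerator_of_opposite_sign (inv_mem (hmem (by simp)))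
      (mul_mem (mul_mem (hmem (by simp)) (hle _ (.inl rfl) hb)) (hle _ (.inl rfl) ha))
      h).isFreeGroup_ker ψ ?_
    rw [map_inv, map_inv]
    exact fun h => he (inv_eq_one.1 h)

theorem OrientableSurfaceGroup.exists_hom_int {g : ℕ} (hg : g ≠ 0) (c : OrientableSurfaceGroup g) :
    ∃ χ : OrientableSurfaceGroup g →* Multiplicative ℤ, χ ≠ 1 ∧ χ c = 1 := by
  have hrel : ∀ f : Fin g ⊕ Fin g → Multiplicative ℤ,
      ∀ r ∈ ({orientableRelator g} : Set _), FreeGroup.lift f r = 1 := by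
    rintro f _ rfl
    rw [orientableRelator, map_list_prod, List.map_ofFn]
    refine List.prod_eq_one fun y hy => ?_
    obtain ⟨i, rfl⟩ := List.mem_ofFn.1 hy
    simp [mul_comm]
  let i : Fin g := ⟨0, Nat.pos_of_ne_zero hg⟩
  have hne : (Multiplicative.ofAdd (1 : ℤ)) ≠ 1 := by decide
  refine exists_hom_int_ne_one_apply_eq_one
    (PresentedGroup.toGroup (hrel (Pi.mulSingle (Sum.inl i) (.ofAdd 1))))
    (PresentedGroup.toGroup (hrel (Pi.mulSingle (Sum.inr i) (.ofAdd 1))))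
    (s := PresentedGroup.of (Sum.inl i)) (t := PresentedGroup.of (Sum.inr i)) ?_ ?_ ?_ c
  · rwa [PresentedGroup.toGroup.of, Pi.mulSingle_eq_same]
  · rw [PresentedGroup.toGroup.of, Pi.mulSingle_eq_of_ne (by simp)]
  · rwa [PresentedGroup.toGroup.of, Pi.mulSingle_eq_same]

/-- Homomorphisms to `ℤ` are integer vectors of sum zero; `eᵢ - eⱼ` and `eⱼ - eₗ` are independent.
For `k = 2` only multiples of `e₁ - e₂` exist, and the nonzero ones do not kill `x₁`. -/
theorem NonorientableSurfaceGroup.exists_hom_int {k : ℕ} (hk : 3 ≤ k)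
    (c : NonorientableSurfaceGroup k) :
    ∃ χ : NonorientableSurfaceGroup k →* Multiplicative ℤ, χ ≠ 1 ∧ χ c = 1 := by
  have hrel : ∀ i j : Fin k, ∀ r ∈ ({nonorientableRelator k} : Set _), FreeGroup.lift
      (fun l => Pi.mulSingle (M := fun _ => Multiplicative ℤ) i (.ofAdd 1) l *
        Pi.mulSingle (M := fun _ => Multiplicative ℤ) j (.ofAdd (-1)) l) r = 1 := by
    rintro i j _ rfl
    rw [nonorientableRelator, map_list_prod, List.map_ofFn, List.prod_ofFn]
    simp only [Function.comp_apply, map_pow, FreeGroup.lift_apply_of, Finset.prod_pow,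
      Finset.prod_mul_distrib, Fintype.prod_pi_mulSingle']
    decide
  let i : Fin k := ⟨0, by omega⟩
  let j : Fin k := ⟨1, by omega⟩
  let l : Fin k := ⟨2, by omega⟩
  have hij : i ≠ j := by simp [i, j]
  have hil : i ≠ l := by simp [i, l]
  have hjl : j ≠ l := by simp [j, l]
  refine exists_hom_int_ne_one_apply_eq_one (PresentedGroup.toGroup (hrel i j))
    (PresentedGroup.toGroup (hrel j l))
    (s := PresentedGroup.of i) (t := PresentedGroup.of j) ?_ ?_ ?_ c
  · rw [PresentedGroup.toGroup.of, Pi.mulSingle_eq_same, Pi.mulSingle_eq_of_ne hij]; decide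
  · rw [PresentedGroup.toGroup.of, Pi.mulSingle_eq_of_ne hij, Pi.mulSingle_eq_of_ne hil, mul_one]
  · rw [PresentedGroup.toGroup.of, Pi.mulSingle_eq_same, Pi.mulSingle_eq_of_ne hjl]; decide

theorem PresentedGroup.isCyclic_of_subsingleton {α : Type*} [Subsingleton α]
    (rels : Set (FreeGroup α)) : IsCyclic (PresentedGroup rels) :=
  have := FreeGroup.isCyclic_of_subsingleton α
  isCyclic_of_surjective (PresentedGroup.mk rels) (PresentedGroup.mk_surjective rels)

theorem corollary4p3 {G : Type*} [Group G] (hG : IsSurfaceGroup G)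
    (hK : ¬ Nonempty (G ≃* KleinBottleGroup)) (C : Subgroup G) (hC : C.IsMaximalCyclic) :
    C.IsLeftRelativelyConvex := by
  rcases hG with ⟨g, ⟨e⟩⟩ | ⟨k, hk, ⟨e⟩⟩
  · rcases eq_or_ne g 0 with rfl | hg
    · have : IsCyclic (OrientableSurfaceGroup 0) := PresentedGroup.isCyclic_of_subsingleton _
      have : IsCyclic G := isCyclic_of_surjective e.symm e.symm.surjective
      exact hC.isLeftRelativelyConvex_of_isCyclic
    · exact hC.isLeftRelativelyConvex_of_isFreeGroup_ker e
        (OrientableSurfaceGroup.exists_hom_int hg)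
        fun _ => OrientableSurfaceGroup.isFreeGroup_ker
  · rcases (by omega : k = 1 ∨ k = 2 ∨ 3 ≤ k) with rfl | rfl | hk
    · have : IsCyclic (NonorientableSurfaceGroup 1) := PresentedGroup.isCyclic_of_subsingleton _
      have : IsCyclic G := isCyclic_of_surjective e.symm e.symm.surjective
      exact hC.isLeftRelativelyConvex_of_isCyclic
    · exact absurd ⟨e⟩ hK
    · exact hC.isLeftRelativelyConvex_of_isFreeGroup_ker e
        (NonorientableSurfaceGroup.exists_hom_int hk)
        fun _ => NonorientableSurfaceGroup.isFreeGroup_ker
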